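/- Let $X$ be a real Banach space. For a norm on $X$ write $\mathbf S_X,\mathbf S_{X^*}$ for the unit spheres of $X$ and $X^*$ and $\mathbf B_{X^*}$ for the closed unit ball of $X^*$. Suppose that $X$ admits an equivalent norm for which both of the following hold. (a) $X^*$ has the property wKK$^*$: for all $x_n^*,x^*\in\mathbf S_{X^*}$ ($n\in\mathbb N$), one has $x_n^*\to x^*$ in the $w^*$-topology if and only if $x_n^*\to x^*$ in the weak topology of $X^*$. (b) At least one of the following conditions is satisfied: (i) for each $x\in\mathbf S_X$ the set $J(x)=\{x^*\in\mathbf S_{X^*}: x^*(x)=1\}$ is first-countable in the $w^*$-topology; (ii) if $Z_n\subset X$ ($n\in\mathbb N$) are closed subspaces such that every $X/Z_n$ is separable, then $X/\bigcap_n Z_n$ is separable; (iii) $X$ has the $1$-separable complementation property: every separable subspace of $X$ is contained in a separable subspace that is the range of a linear projection $P\colon X\to X$ with $\|P\|\le 1$; (iv) $\mathbf B_{X^*}$ is $w^*$-sequentially compact. Then $X$ is an Asplund space, i.e. every continuous convex function on an open convex set $U\subset X$ is Fréchet differentiable at each point of a dense $G_\delta$ subset of $U$. Moreover, $\mathbf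 B_{X^*}$ is $w^*$-sequentially compact, so that (iv) holds, whenever $X$ is a Gateaux differentiability space (every continuous convex function on $X$ is Gateaux differentiable at each point of a dense set), and in particular whenever $X$ is a weak Asplund space (the same with a dense $G_\delta$ set). -/

import Mathlib

open Set Filter Topology

universe u

noncomputable section

/-- `X` is an Asplund space: every continuous convex function on an open convex subset `U` of `X`
is Fréchet differentiable at each point of some dense `G_δ` subset of `U`. -/
def IsAsplund (X : Type*) [NormedAddCommGroup X] [NormedSpace ℝ X] : Prop :=
  ∀ (U : Set X) (f : X → ℝ), IsOpen U → ConvexOn ℝ U f → ContinuousOn f U →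
    ∃ D : Set X, D ⊆ U ∧ IsGδ D ∧ U ⊆ closure D ∧ ∀ x ∈ D, DifferentiableAt ℝ f x

/-- `f` is Gateaux differentiable at `x`: all directional derivatives exist and they are given by
a continuous linear functional. -/
def GateauxDifferentiableAt {X : Type*} [NormedAddCommGroup X] [NormedSpace ℝ X]
    (f : X → ℝ) (x : X) : Prop :=
  ∃ L : StrongDual ℝ X, ∀ h : X, HasLineDerivAt ℝ f (L h) x h

/-- `X` is a Gateaux differentiability space: every continuous convex function on `X` is Gateaux
differentiable on a dense set. -/
def IsGDS (X : Type*) [NormedAddCommGroup X] [NormedSpace ℝ X] : Prop :=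
  ∀ f : X → ℝ, ConvexOn ℝ univ f → Continuous f →
    ∃ D : Set X, Dense D ∧ ∀ x ∈ D, GateauxDifferentiableAt f x

/-- `X` is a weak Asplund space: every continuous convex function on `X` is Gateaux
differentiable on a dense `G_δ` set. -/
def IsWeakAsplund (X : Type*) [NormedAddCommGroup X] [NormedSpace ℝ X] : Prop :=
  ∀ f : X → ℝ, ConvexOn ℝ univ f → Continuous f →
    ∃ D : Set X, Dense D ∧ IsGδ D ∧ ∀ x ∈ D, GateauxDifferentiableAt f x

/-- The dual of `X` has the dual weak Kadec-Klee property: for sequences in the dual unit sphere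
and limits in the dual unit sphere, weak-star convergence and weak convergence coincide. -/
def DualWeakKadecKlee (X : Type*) [NormedAddCommGroup X] [NormedSpace ℝ X] : Prop :=
  ∀ (f : ℕ → StrongDual ℝ X) (g : StrongDual ℝ X), (∀ n, ‖f n‖ = 1) → ‖g‖ = 1 →
    (Tendsto (fun n => StrongDual.toWeakDual (f n)) atTop (𝓝 (StrongDual.toWeakDual g)) ↔
      Tendsto (fun n => toWeakSpace ℝ (StrongDual ℝ X) (f n)) atTop
        (𝓝 (toWeakSpace ℝ (StrongDual ℝ X) g)))

/-- The duality mapping `J(x) = {x* : ‖x*‖ = 1, x*(x) = 1}`, with values regarded as subsets of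
the dual with its weak-star topology. -/
def dualityMap {X : Type*} [NormedAddCommGroup X] [NormedSpace ℝ X] (x : X) :
    Set (WeakDual ℝ X) :=
  {f | ‖WeakDual.toStrongDual f‖ = 1 ∧ f x = 1}

/-- For every `x` in the unit sphere, `J(x)` is first countable in the weak-star topology. -/
def DualityMapFirstCountable (X : Type*) [NormedAddCommGroup X] [NormedSpace ℝ X] : Prop :=
  ∀ x : X, ‖x‖ = 1 → FirstCountableTopology (dualityMap x)

/-- The closed subspace `Y` is coseparable in `X`: the quotient `X ⧸ Y` is separable. -/
def IsCoseparable {X : Type*} [NormedAddCommGroup X] [NormedSpace ℝ X]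
    (Y : Submodule ℝ X) : Prop :=
  IsClosed (Y : Set X) ∧ TopologicalSpace.SeparableSpace (X ⧸ Y)

/-- Countable intersections of coseparable (closed) subspaces of `X` are coseparable. -/
def CoseparableInter (X : Type*) [NormedAddCommGroup X] [NormedSpace ℝ X] : Prop :=
  ∀ Z : ℕ → Submodule ℝ X, (∀ n, IsCoseparable (Z n)) → IsCoseparable (⨅ n, Z n)

/-- The `1`-separable complementation property: every separable subspace of `X` is contained in a
separable subspace that is the range of a linear projection of norm at most one. -/
def HasOneSCP (X : Type*) [NormedAddCommGroup X] [NormedSpace ℝ X] : Prop :=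
  ∀ Y : Submodule ℝ X, TopologicalSpace.IsSeparable (Y : Set X) →
    ∃ (Z : Submodule ℝ X) (P : X →L[ℝ] X), TopologicalSpace.IsSeparable (Z : Set X) ∧ Y ≤ Z ∧
      ‖P‖ ≤ 1 ∧ (∀ x, P (P x) = P x) ∧ range P = (Z : Set X)

/-- The closed dual unit ball is sequentially compact in the weak-star topology. -/
def DualBallSeqCompact (X : Type*) [NormedAddCommGroup X] [NormedSpace ℝ X] : Prop :=
  IsSeqCompact {f : WeakDual ℝ X | ‖WeakDual.toStrongDual f‖ ≤ 1}

end

/-!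
The Asplund property follows once every separable closed subspace `Y` has a separable dual
(`isAsplund_of_separable_dual_of_separable`). If `Y*` is separable, a Baire category argument on the
sets where a fixed functional is an `ε`-subgradient of a convex function `f` on `Y` produces points
near which the second differences of `f` are at most `ε * ‖h‖`
(`exists_nearlySmoothAt_of_separable_dual`). Such points form an open set, and if they failed to be
dense in `X`, countably many witnesses would already exhibit the failure in a separable subspace.

To see that `Y*` is separable, take a countable set `D`, weak-star sequentially dense in its unit
sphere. If a sequence in `D` converges weak-star to `g` of norm one and lifts to a weak-star
convergent sequence in the dual sphere of `X`, the weak Kadec-Klee property makes the latter converge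
weakly, so `g` lies in the norm-closed span of `D` (`DualWeakKadecKlee.comp_subtypeL_mem`). Each of
the four hypotheses provides enough lifts:
* with a weak-star sequentially compact dual ball, pass to a subsequence of Hahn-Banach extensions;
* if coseparable subspaces are stable under countable intersections, a sequence of functionals lives
  on the separable quotient by the intersection of its kernels, so that the dual ball is again
  sequentially compact;
* with norm-one projections, enlarge `Y` to a complemented subspace and compose with the projection;
* with first countable sets `J(x)`, the extensions of a sequence tending to a functional that attains
  its norm at `y` cluster only in `J(y)`, and a countable base of neighbourhoods in `J(y)` suffices to
  extract a convergent subsequence; by the Bishop-Phelps theorem these functionals are dense.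

For a Gateaux differentiability space, a sequence of functionals has a subsequence converging to
the gradient of its upper envelope `x ↦ limsup (f n x)` at any point where this exists
(`IsGDS.dualBallSeqCompact`).
-/

section

variable {X : Type*} [NormedAddCommGroup X] [NormedSpace ℝ X]

/-! ### Subgradients and near smoothness -/

/-- Subgradients exist at points of continuity: separate the open strict epigraph from the graph
point. -/
theorem ConvexOn.exists_subgradient {U : Set X} {f : X → ℝ} (hU : IsOpen U) (hf : ConvexOn ℝ U f)
    (hc : ContinuousOn f U) {x : X} (hx : x ∈ U) :
    ∃ g : StrongDual ℝ X, ∀ y ∈ U, f x + g (y - x) ≤ f y := by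
  have hopen : IsOpen {p : X × ℝ | p.1 ∈ U ∧ f p.1 < p.2} := by
    have h1 : ContinuousOn (fun p : X × ℝ => f p.1 - p.2) (Prod.fst ⁻¹' U) :=
      (hc.comp continuous_fst.continuousOn fun p hp => hp).sub continuous_snd.continuousOn
    have h2 := h1.isOpen_inter_preimage (hU.preimage continuous_fst) (isOpen_Iio (a := (0 : ℝ)))
    convert h2 using 1
    ext p
    simp
  obtain ⟨φ, hφ⟩ := geometric_hahn_banach_open_point (x := (x, f x)) hf.convex_strict_epigraph
    hopen (by simp)
  have hsplit : ∀ (y : X) (t : ℝ), φ (y, t) = φ (y, 0) + t * φ (0, 1) := fun y t => by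
    have : (y, t) = (y, (0 : ℝ)) + t • ((0 : X), (1 : ℝ)) := by simp
    rw [this, map_add, map_smul, smul_eq_mul]
  have hs : φ (0, 1) < 0 := by
    have h := hφ (x, f x + 1) ⟨hx, by simp⟩
    rw [hsplit x (f x + 1), hsplit x (f x)] at h
    linarith
  have key : ∀ y ∈ U, φ (y, 0) + f y * φ (0, 1) ≤ φ (x, 0) + f x * φ (0, 1) := by
    intro y hy
    refine le_of_forall_pos_lt_add fun ε hε => ?_
    have h := hφ (y, f y + ε / (-φ (0, 1))) ⟨hy, by
      have : 0 < ε / (-φ (0, 1)) := div_pos hε (by linarith)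
      simpa using this⟩
    rw [hsplit y, hsplit x (f x), add_mul] at h
    have h2 : ε / (-φ (0, 1)) * φ (0, 1) = -ε := by
      rw [div_neg, neg_mul, div_mul_cancel₀ _ hs.ne]
    linarith
  refine ⟨(-φ (0, 1))⁻¹ • φ.comp (ContinuousLinearMap.inl ℝ X ℝ), fun y hy => ?_⟩
  have h1 := key y hy
  have h2 : φ (y - x, 0) = φ (y, 0) - φ (x, 0) := by rw [← map_sub]; simp
  have h3 : (-φ (0, 1))⁻¹ * (φ (y, 0) - φ (x, 0)) ≤ f y - f x := by
    rw [inv_mul_le_iff₀ (by linarith)]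
    linarith
  simp only [smul_apply, ContinuousLinearMap.comp_apply, smul_eq_mul,
    ContinuousLinearMap.inl_apply, h2]
  linarith

/-- `f` is `ε`-smooth near `x`: the symmetric second differences of `f` at all points `y` near `x`
are at most `ε * ‖h‖` for small increments `h`. Moving the base point `y` as well makes the set of
such `x` open. -/
def NearlySmoothAt (f : X → ℝ) (ε : ℝ) (x : X) : Prop :=
  ∃ δ > 0, ∀ y h : X, ‖y - x‖ < δ → ‖h‖ < δ → f (y + h) + f (y - h) - 2 * f y ≤ ε * ‖h‖

theorem isOpen_nearlySmoothAt {E : Type*} [NormedAddCommGroup E] (f : E → ℝ) (ε : ℝ) :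
    IsOpen {x | NearlySmoothAt f ε x} := by
  rw [Metric.isOpen_iff]
  rintro x ⟨δ, hδ, h⟩
  refine ⟨δ / 2, by positivity, fun z hz => ⟨δ / 2, by positivity, fun y k hy hk => ?_⟩⟩
  refine h y k ?_ (by linarith)
  rw [mem_ball_iff_norm] at hz
  calc ‖y - x‖ = ‖(y - z) + (z - x)‖ := by congr 1; abel
    _ ≤ ‖y - z‖ + ‖z - x‖ := norm_add_le _ _
    _ < δ := by linarith

/-- A convex function whose second differences at `x` are `o(‖h‖)` is Fréchet differentiable at
`x`; the derivative is any subgradient. -/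
theorem ConvexOn.differentiableAt_of_nearlySmoothAt {U : Set X} {f : X → ℝ} (hU : IsOpen U)
    (hf : ConvexOn ℝ U f) (hc : ContinuousOn f U) {x : X} (hx : x ∈ U)
    (h : ∀ ε > 0, NearlySmoothAt f ε x) : DifferentiableAt ℝ f x := by
  obtain ⟨g, hg⟩ := hf.exists_subgradient hU hc hx
  refine HasFDerivAt.differentiableAt (f' := g) ?_
  rw [hasFDerivAt_iff_isLittleO_nhds_zero, Asymptotics.isLittleO_iff]
  intro ε hε
  obtain ⟨δ, hδ, H⟩ := h ε hε
  obtain ⟨r, hr, hrU⟩ := Metric.isOpen_iff.1 hU x hx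
  filter_upwards [Metric.ball_mem_nhds (0 : X) (lt_min hδ hr)] with k hk
  rw [mem_ball_zero_iff, lt_min_iff] at hk
  have h1 := hg (x + k) (hrU (by simpa using hk.2))
  have h2 := hg (x - k) (hrU (by simpa using hk.2))
  have h3 := H x k (by simpa using hδ) hk.1
  have e1 : x + k - x = k := by abel
  have e2 : x - k - x = -k := by abel
  rw [e1] at h1
  rw [e2, map_neg] at h2
  rw [Real.norm_eq_abs, abs_le]
  constructor <;> nlinarith [norm_nonneg k]

/-! ### Separable duals of separable subspaces imply the Asplund property -/

/-- When the dual is separable, cover the ball by the countably many relatively closed sets of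
points at which a member `g k` of a dense sequence is an `ε`-subgradient; by the Baire category
theorem one of them has interior, and there `f` is nearly smooth. -/
theorem exists_nearlySmoothAt_of_separable_dual [CompleteSpace X]
    [TopologicalSpace.SeparableSpace (StrongDual ℝ X)] {f : X → ℝ} {x₀ : X} {r ε : ℝ} (hr : 0 < r)
    (hf : ConvexOn ℝ (Metric.ball x₀ r) f) (hc : ContinuousOn f (Metric.ball x₀ r)) (hε : 0 < ε) :
    ∃ z ∈ Metric.ball x₀ r, NearlySmoothAt f ε z := by
  set B := Metric.ball x₀ r with hB
  have hBo : IsOpen B := Metric.isOpen_ball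
  let g := TopologicalSpace.denseSeq (StrongDual ℝ X)
  let A : ℕ → Set X := fun k =>
    {x | x ∈ B → ∀ y ∈ B, f x + g k (y - x) - ε / 2 * ‖y - x‖ ≤ f y}
  have hA : ∀ k, IsClosed (A k) := by
    intro k
    rw [← isOpen_compl_iff]
    have : (A k)ᶜ = ⋃ y ∈ B, B ∩ {x | f y < f x + g k (y - x) - ε / 2 * ‖y - x‖} := by
      ext x
      simp only [A, mem_compl_iff, mem_ofPred_eq, mem_iUnion, mem_inter_iff]
      push Not
      constructor
      · rintro ⟨h1, y, h2, h3⟩; exact ⟨y, h2, h1, h3⟩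
      · rintro ⟨y, h2, h1, h3⟩; exact ⟨h1, y, h2, h3⟩
    rw [this]
    refine isOpen_biUnion fun y _ => ?_
    have hcont : ContinuousOn (fun x => f x + g k (y - x) - ε / 2 * ‖y - x‖) B := by
      refine (hc.add ?_).sub ?_ <;> exact Continuous.continuousOn (by fun_prop)
    exact hcont.isOpen_inter_preimage hBo (isOpen_Ioi (a := f y))
  have hcov : ⋃ k, A k = univ := by
    refine eq_univ_of_forall fun x => mem_iUnion.2 ?_
    by_cases hx : x ∈ B
    · obtain ⟨G, hG⟩ := hf.exists_subgradient hBo hc hx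
      obtain ⟨k, hk⟩ := (TopologicalSpace.denseRange_denseSeq (StrongDual ℝ X)).exists_dist_lt G
        (half_pos hε)
      refine ⟨k, fun _ y hy => ?_⟩
      have h1 := hG y hy
      have h2 : g k (y - x) - G (y - x) ≤ ε / 2 * ‖y - x‖ := by
        rw [dist_comm, dist_eq_norm] at hk
        calc g k (y - x) - G (y - x) = (g k - G) (y - x) := rfl
          _ ≤ ‖(g k - G) (y - x)‖ := Real.le_norm_self _
          _ ≤ ‖g k - G‖ * ‖y - x‖ := ContinuousLinearMap.le_opNorm _ _
          _ ≤ ε / 2 * ‖y - x‖ := by gcongr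
      linarith
    · exact ⟨0, fun h => absurd h hx⟩
  obtain ⟨z, hz, hzB⟩ := (dense_iUnion_interior_of_closed hA hcov).exists_mem_open hBo
    ⟨x₀, Metric.mem_ball_self hr⟩
  obtain ⟨k, hk⟩ := mem_iUnion.1 hz
  obtain ⟨δ, hδ, hsub⟩ := Metric.isOpen_iff.1 (isOpen_interior.inter hBo) z ⟨hk, hzB⟩
  have hV : ∀ y, ‖y - z‖ < δ → y ∈ A k ∧ y ∈ B := fun y hy =>
    ⟨interior_subset (hsub (mem_ball_iff_norm.2 hy)).1, (hsub (mem_ball_iff_norm.2 hy)).2⟩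
  refine ⟨z, hzB, δ / 2, by positivity, fun y h hy hh => ?_⟩
  have b0 := hV y (by linarith)
  have b1 := hV (y + h) (by
    have := norm_add_le (y - z) h
    rw [show y + h - z = (y - z) + h by abel]; linarith)
  have b2 := hV (y - h) (by
    have := norm_sub_le (y - z) h
    rw [show y - h - z = (y - z) - h by abel]; linarith)
  have i1 := b1.1 b1.2 y b0.2
  have i2 := b2.1 b2.2 y b0.2
  rw [show y - (y + h) = -h by abel, map_neg, norm_neg] at i1
  rw [show y - (y - h) = h by abel] at i2
  linarith

/-- Closing off under countably many operations: a point `x₀` lies in a separable closed subspace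
`Y` in which the points `x` with all `F m x` in `Y` are dense. -/
theorem exists_separable_subspace_dense_invariant (x₀ : X) (F : ℕ → X → X) :
    ∃ Y : Submodule ℝ X, IsClosed (Y : Set X) ∧ TopologicalSpace.IsSeparable (Y : Set X) ∧
      x₀ ∈ Y ∧ ∀ x ∈ Y, ∀ δ > 0, ∃ x' ∈ Y, ‖x' - x‖ < δ ∧ ∀ m, F m x' ∈ Y := by
  have hdense : ∀ A : Set X, ∃ d : Set X, A.Countable →
      d.Countable ∧ d ⊆ Submodule.span ℝ A ∧ (Submodule.span ℝ A : Set X) ⊆ closure d := by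
    intro A
    by_cases hA : A.Countable
    · obtain ⟨d, hd, hdc, hcl⟩ := (TopologicalSpace.IsSeparable.span (R := ℝ)
        hA.isSeparable).exists_countable_dense_subset
      exact ⟨d, fun _ => ⟨hdc, hd, hcl⟩⟩
    · exact ⟨∅, fun h => absurd h hA⟩
  choose d hd using hdense
  let A : ℕ → Set X := fun k =>
    Nat.rec {x₀} (fun _ S => S ∪ ⋃ m, F m '' d S) k
  have hA0 : A 0 = {x₀} := rfl
  have hAs : ∀ k, A (k + 1) = A k ∪ ⋃ m, F m '' d (A k) := fun k => rfl
  have hAc : ∀ k, (A k).Countable := by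
    intro k
    induction k with
    | zero => rw [hA0]; exact countable_singleton _
    | succ k ih =>
      rw [hAs]
      exact ih.union (countable_iUnion fun m => (hd _ ih).1.image _)
  have hmono : Monotone A := monotone_nat_of_le_succ fun k => by
    rw [hAs]; exact subset_union_left
  have hspan : Submodule.span ℝ (⋃ k, A k) = ⨆ k, Submodule.span ℝ (A k) :=
    Submodule.span_iUnion _
  refine ⟨(Submodule.span ℝ (⋃ k, A k)).topologicalClosure,
    Submodule.isClosed_topologicalClosure _, ?_, ?_, ?_⟩
  · rw [Submodule.topologicalClosure_coe]
    exact ((countable_iUnion hAc).isSeparable.span (R := ℝ)).closure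
  · refine Submodule.le_topologicalClosure _ (Submodule.subset_span (mem_iUnion.2 ⟨0, ?_⟩))
    rw [hA0]; rfl
  · intro x hx δ hδ
    rw [← SetLike.mem_coe, Submodule.topologicalClosure_coe, Metric.mem_closure_iff] at hx
    obtain ⟨y, hy, hxy⟩ := hx (δ / 2) (half_pos hδ)
    rw [SetLike.mem_coe, hspan, Submodule.mem_iSup_of_directed _
      (Monotone.directed_le fun i j hij => Submodule.span_mono (hmono hij))] at hy
    obtain ⟨k, hk⟩ := hy
    obtain ⟨z, hz, hyz⟩ := Metric.mem_closure_iff.1 ((hd _ (hAc k)).2.2 hk) (δ / 2) (half_pos hδ)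
    refine ⟨z, ?_, ?_, fun m => ?_⟩
    · exact Submodule.le_topologicalClosure _
        (Submodule.span_mono (subset_iUnion A k) ((hd _ (hAc k)).2.1 hz))
    · rw [← dist_eq_norm, dist_comm]
      linarith [dist_triangle x y z]
    · refine Submodule.le_topologicalClosure _ (Submodule.subset_span (mem_iUnion.2 ⟨k + 1, ?_⟩))
      rw [hAs]
      exact Or.inr (mem_iUnion.2 ⟨m, mem_image_of_mem _ hz⟩)

/-- Separable reduction: failure of near smoothness throughout a ball is inherited by a suitable
separable closed subspace, since it is witnessed by countably many vectors. -/
theorem exists_nearlySmoothAt [CompleteSpace X]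
    (hX : ∀ Y : Submodule ℝ X, IsClosed (Y : Set X) → TopologicalSpace.IsSeparable (Y : Set X) →
      TopologicalSpace.SeparableSpace (StrongDual ℝ Y))
    {f : X → ℝ} {x₀ : X} {r ε : ℝ} (hr : 0 < r)
    (hf : ConvexOn ℝ (Metric.ball x₀ r) f) (hc : ContinuousOn f (Metric.ball x₀ r)) (hε : 0 < ε) :
    ∃ z ∈ Metric.ball x₀ r, NearlySmoothAt f ε z := by
  by_contra! hbad
  have hw : ∀ (m : ℕ) (x : X), ∃ p : X × X, x ∈ Metric.ball x₀ r →
      ‖p.1 - x‖ < 1 / (m + 1 : ℝ) ∧ ‖p.2‖ < 1 / (m + 1 : ℝ) ∧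
        ε * ‖p.2‖ < f (p.1 + p.2) + f (p.1 - p.2) - 2 * f p.1 := by
    intro m x
    by_cases hx : x ∈ Metric.ball x₀ r
    · have h := hbad x hx
      unfold NearlySmoothAt at h
      push Not at h
      obtain ⟨y, k, h1, h2, h3⟩ := h (1 / (m + 1 : ℝ)) (by positivity)
      exact ⟨(y, k), fun _ => ⟨h1, h2, h3⟩⟩
    · exact ⟨0, fun h => absurd h hx⟩
  choose p hp using hw
  -- Even indices return the base points, odd indices the increments.
  obtain ⟨Y, hYc, hYs, hx₀, hY⟩ := exists_separable_subspace_dense_invariant x₀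
    (fun n x => if Even n then (p (n / 2) x).1 else (p (n / 2) x).2)
  have hY1 : ∀ x ∈ Y, ∀ δ > 0, ∃ x' ∈ Y, ‖x' - x‖ < δ ∧ ∀ m, (p m x').1 ∈ Y ∧ (p m x').2 ∈ Y := by
    intro x hx δ hδ
    obtain ⟨x', h1, h2, h3⟩ := hY x hx δ hδ
    refine ⟨x', h1, h2, fun m => ⟨?_, ?_⟩⟩
    · simpa using h3 (2 * m)
    · have := h3 (2 * m + 1)
      rwa [if_neg (by simp), show (2 * m + 1) / 2 = m by omega] at this
  have : CompleteSpace Y := hYc.completeSpace_coe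
  have := hX Y hYc hYs
  have hball : ∀ y : Y, y ∈ Metric.ball (⟨x₀, hx₀⟩ : Y) r ↔ (y : X) ∈ Metric.ball x₀ r :=
    fun y => Iff.rfl
  obtain ⟨z, hz, δ, hδ, H⟩ := exists_nearlySmoothAt_of_separable_dual (X := Y)
    (f := fun y => f y) (x₀ := ⟨x₀, hx₀⟩) (ε := ε) hr
    (hf.comp_linearMap Y.subtype) (hc.comp continuous_subtype_val.continuousOn fun y hy => hy) hε
  obtain ⟨ρ, hρ, hρsub⟩ := Metric.isOpen_iff.1 Metric.isOpen_ball (z : X) ((hball z).1 hz)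
  obtain ⟨x', hx'Y, hx', hpY⟩ := hY1 z z.2 (min ρ (δ / 2)) (lt_min hρ (half_pos hδ))
  obtain ⟨m, hm⟩ := exists_nat_one_div_lt (half_pos hδ)
  rw [lt_min_iff] at hx'
  obtain ⟨h1, h2, h3⟩ := hp m x' (hρsub (mem_ball_iff_norm.2 hx'.1))
  have h4 := H ⟨_, (hpY m).1⟩ ⟨_, (hpY m).2⟩ (by
    change ‖(p m x').1 - (z : X)‖ < δ
    calc ‖(p m x').1 - (z : X)‖ = ‖((p m x').1 - x') + (x' - z)‖ := by congr 1; abel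
      _ ≤ ‖(p m x').1 - x'‖ + ‖x' - z‖ := norm_add_le _ _
      _ < δ := by linarith) (by
    change ‖(p m x').2‖ < δ
    linarith)
  exact absurd h4 (not_le.2 h3)

theorem isAsplund_of_separable_dual_of_separable [CompleteSpace X]
    (hX : ∀ Y : Submodule ℝ X, IsClosed (Y : Set X) → TopologicalSpace.IsSeparable (Y : Set X) →
      TopologicalSpace.SeparableSpace (StrongDual ℝ Y)) : IsAsplund X := by
  intro U f hU hf hc
  let G : ℕ → Set X := fun n => {x | NearlySmoothAt f (1 / (n + 1 : ℝ)) x}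
  have hGo : ∀ n, IsOpen (G n) := fun n => isOpen_nearlySmoothAt f _
  -- Adding the exterior of `U` turns density in `U` into density in the whole space.
  have hdense : ∀ n, Dense (G n ∩ U ∪ (closure U)ᶜ) := by
    intro n
    rw [dense_iff_inter_open]
    rintro V hV ⟨v, hv⟩
    by_cases hvU : v ∈ closure U
    · obtain ⟨x, hxV, hxU⟩ := mem_closure_iff.1 hvU V hV hv
      obtain ⟨r, hr, hrs⟩ := Metric.isOpen_iff.1 (hV.inter hU) x ⟨hxV, hxU⟩
      obtain ⟨z, hz, hzs⟩ := exists_nearlySmoothAt hX (ε := 1 / (n + 1 : ℝ)) hr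
        (hf.subset (fun y hy => (hrs hy).2) (convex_ball x r))
        (hc.mono fun y hy => (hrs hy).2) (by positivity)
      exact ⟨z, (hrs hz).1, Or.inl ⟨hzs, (hrs hz).2⟩⟩
    · exact ⟨v, hv, Or.inr hvU⟩
  have hopen : ∀ n, IsOpen (G n ∩ U ∪ (closure U)ᶜ) := fun n =>
    ((hGo n).inter hU).union isClosed_closure.isOpen_compl
  have hD := dense_iInter_of_isOpen_nat hopen hdense
  refine ⟨(⋂ n, G n) ∩ U, inter_subset_right,
    (IsGδ.iInter_of_isOpen hGo).inter hU.isGδ, fun x hx => ?_, fun x hx => ?_⟩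
  · rw [mem_closure_iff]
    intro V hV hxV
    obtain ⟨z, hz, hzV, hzU⟩ := hD.exists_mem_open (hV.inter hU) ⟨x, hxV, hx⟩
    refine ⟨z, hzV, mem_iInter.2 fun n => ?_, hzU⟩
    rcases mem_iInter.1 hz n with h | h
    · exact h.1
    · exact absurd (subset_closure hzU) h
  · refine hf.differentiableAt_of_nearlySmoothAt hU hc hx.2 fun ε hε => ?_
    obtain ⟨n, hn⟩ := exists_nat_one_div_lt hε
    obtain ⟨δ, hδ, h⟩ := mem_iInter.1 hx.1 n
    exact ⟨δ, hδ, fun y k hy hk => (h y k hy hk).trans (by gcongr)⟩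

theorem IsAsplund.of_continuousLinearEquiv {Y : Type*} [NormedAddCommGroup Y] [NormedSpace ℝ Y]
    (e : X ≃L[ℝ] Y) (hY : IsAsplund Y) : IsAsplund X := by
  intro U f hU hf hc
  obtain ⟨D, hDU, hDG, hUD, hdiff⟩ := hY (e.symm ⁻¹' U) (f ∘ e.symm)
    (hU.preimage e.symm.continuous) (hf.comp_linearMap e.symm.toLinearEquiv.toLinearMap)
    (hc.comp e.symm.continuous.continuousOn fun y hy => hy)
  refine ⟨e ⁻¹' D, fun x hx => by simpa using hDU hx, hDG.preimage e.continuous, fun x hx => ?_,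
    fun x hx => ?_⟩
  · have : e ⁻¹' closure D = closure (e ⁻¹' D) := e.toHomeomorph.preimage_closure D
    rw [← this]
    exact hUD (by simpa using hx)
  · have h := (hdiff (e x) hx).comp x e.differentiableAt
    have h2 : (f ∘ e.symm) ∘ e = f := by ext; simp
    rwa [h2] at h

/-! ### Lifting weak-star limits and separability of duals -/

theorem tendsto_toWeakDual_iff {ι : Type*} {l : Filter ι} {f : ι → StrongDual ℝ X}
    {g : StrongDual ℝ X} :
    Tendsto (fun n => StrongDual.toWeakDual (f n)) l (𝓝 (StrongDual.toWeakDual g)) ↔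
      ∀ x, Tendsto (fun n => f n x) l (𝓝 (g x)) :=
  tendsto_iff_forall_eval_tendsto_topDualPairing

theorem norm_comp_subtypeL_le (Y : Submodule ℝ X) (G : StrongDual ℝ X) :
    ‖G.comp Y.subtypeL‖ ≤ ‖G‖ :=
  ContinuousLinearMap.opNorm_le_bound _ (norm_nonneg _) fun y => G.le_opNorm y

/-- The weak Kadec-Klee property upgrades weak-star convergence on the sphere to weak convergence,
and by Mazur's theorem weak limits stay in closed subspaces, also after restriction to `Y`. -/
theorem DualWeakKadecKlee.comp_subtypeL_mem (hX : DualWeakKadecKlee X) {Y : Submodule ℝ X}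
    {W : Submodule ℝ (StrongDual ℝ Y)} (hW : IsClosed (W : Set (StrongDual ℝ Y)))
    {F : ℕ → StrongDual ℝ X} {G : StrongDual ℝ X} (hF : ∀ n, ‖F n‖ = 1) (hG : ‖G‖ = 1)
    (hlim : ∀ x, Tendsto (fun n => F n x) atTop (𝓝 (G x)))
    (hFW : ∀ n, (F n).comp Y.subtypeL ∈ W) : G.comp Y.subtypeL ∈ W := by
  by_contra hGW
  obtain ⟨φ, u, hφ, hu⟩ := geometric_hahn_banach_closed_point W.convex hW hGW
  let R : StrongDual ℝ X →L[ℝ] StrongDual ℝ Y :=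
    (ContinuousLinearMap.compL ℝ Y X ℝ).flip Y.subtypeL
  have hw := (hX F G hF hG).1 (tendsto_toWeakDual_iff.2 hlim)
  have h1 := ((WeakBilin.eval_continuous (topDualPairing ℝ (StrongDual ℝ X)).flip
    (φ.comp R)).tendsto _).comp hw
  have h2 : Tendsto (fun n => φ ((F n).comp Y.subtypeL)) atTop (𝓝 (φ (G.comp Y.subtypeL))) := h1
  exact absurd (le_of_tendsto' h2 fun n => (hφ _ (hFW n)).le) (not_le.2 hu)

/-- For every sequence in the dual unit sphere of the subspace `Y` that is weak-star convergent to
`g`, some sequence made of terms of it (a subsequence, in the uses below) extends to a weak-star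
convergent sequence in the dual unit sphere of `X`, with a limit in that sphere extending `g`. -/
def LiftsSphereLimits (Y : Submodule ℝ X) (g : StrongDual ℝ Y) : Prop :=
  ∀ f : ℕ → StrongDual ℝ Y, (∀ n, ‖f n‖ = 1) → (∀ y, Tendsto (fun n => f n y) atTop (𝓝 (g y))) →
    ∃ (F : ℕ → StrongDual ℝ X) (G : StrongDual ℝ X), (∀ n, ‖F n‖ = 1) ∧ ‖G‖ = 1 ∧
      (∀ x, Tendsto (fun n => F n x) atTop (𝓝 (G x))) ∧
      (∀ n, (F n).comp Y.subtypeL ∈ range f) ∧ G.comp Y.subtypeL = g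

/-- The dual unit sphere of a separable space is weak-star sequentially separable, being a subset of
a compact metrizable space. -/
theorem exists_countable_seq_dense_dual_sphere (E : Type*) [NormedAddCommGroup E]
    [NormedSpace ℝ E] [TopologicalSpace.SeparableSpace E] :
    ∃ D : Set (StrongDual ℝ E), D.Countable ∧ (∀ f ∈ D, ‖f‖ = 1) ∧
      ∀ g : StrongDual ℝ E, ‖g‖ = 1 →
        ∃ f : ℕ → StrongDual ℝ E, (∀ n, f n ∈ D) ∧
          ∀ x, Tendsto (fun n => f n x) atTop (𝓝 (g x)) := by
  let K : Set (WeakDual ℝ E) := WeakDual.toStrongDual ⁻¹' Metric.closedBall 0 1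
  have hK : IsCompact K := WeakDual.isCompact_closedBall 0 1
  have := WeakDual.metrizable_of_isCompact ℝ E K hK
  have := isCompact_iff_compactSpace.1 hK
  have : SecondCountableTopology K := inferInstance
  let S : Set K := {f | ‖WeakDual.toStrongDual (f : WeakDual ℝ E)‖ = 1}
  obtain ⟨D, hDS, hDc, hD⟩ :=
    (TopologicalSpace.IsSeparable.of_separableSpace S).exists_countable_dense_subset
  refine ⟨(fun f : K => WeakDual.toStrongDual (f : WeakDual ℝ E)) '' D, hDc.image _, ?_, ?_⟩
  · rintro _ ⟨f, hf, rfl⟩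
    exact hDS hf
  · intro g hg
    have hgK : StrongDual.toWeakDual g ∈ K := by
      exact mem_closedBall_zero_iff.2 hg.le
    obtain ⟨f, hf, hlim⟩ := mem_closure_iff_seq_limit.1
      (hD (show (⟨StrongDual.toWeakDual g, hgK⟩ : K) ∈ S from hg))
    refine ⟨fun n => WeakDual.toStrongDual (f n : WeakDual ℝ E), fun n => ⟨f n, hf n, rfl⟩, ?_⟩
    exact tendsto_toWeakDual_iff.1 ((continuous_subtype_val.tendsto _).comp hlim)

/-- The functionals to which sphere limits can be lifted lie in the closed span of a countable set;
so the dual of `Y` is separable once these functionals span it topologically. -/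
theorem DualWeakKadecKlee.separableSpace_dual (hX : DualWeakKadecKlee X) {Y : Submodule ℝ X}
    (hY : TopologicalSpace.IsSeparable (Y : Set X))
    (hd : ∀ W : Submodule ℝ (StrongDual ℝ Y), IsClosed (W : Set (StrongDual ℝ Y)) →
      (∀ g : StrongDual ℝ Y, ‖g‖ = 1 → LiftsSphereLimits Y g → g ∈ W) → W = ⊤) :
    TopologicalSpace.SeparableSpace (StrongDual ℝ Y) := by
  have : TopologicalSpace.SeparableSpace Y := hY.separableSpace
  obtain ⟨D, hDc, hD1, hD⟩ := exists_countable_seq_dense_dual_sphere Y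
  have htop := hd (Submodule.span ℝ D).topologicalClosure
    (Submodule.isClosed_topologicalClosure _) fun g hg hlift => by
      obtain ⟨f, hfD, hf⟩ := hD g hg
      obtain ⟨F, G, hF, hG, hlim, hFf, hGg⟩ := hlift f (fun n => hD1 _ (hfD n)) hf
      rw [← hGg]
      refine hX.comp_subtypeL_mem (Submodule.isClosed_topologicalClosure _) hF hG hlim fun n => ?_
      obtain ⟨m, hm⟩ := hFf n
      rw [← hm]
      exact Submodule.le_topologicalClosure _ (Submodule.subset_span (hfD m))
  have hsep := (hDc.isSeparable.span (R := ℝ)).closure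
  rw [← Submodule.topologicalClosure_coe, htop, Submodule.top_coe] at hsep
  exact TopologicalSpace.isSeparable_univ_iff.1 hsep

theorem eq_top_of_sphere_subset {E : Type*} [NormedAddCommGroup E] [NormedSpace ℝ E]
    {W : Submodule ℝ E} (hW : ∀ g : E, ‖g‖ = 1 → g ∈ W) : W = ⊤ := by
  refine Submodule.eq_top_iff'.2 fun g => ?_
  rcases eq_or_ne g 0 with rfl | hg
  · exact W.zero_mem
  · have h := W.smul_mem ‖g‖ (hW (‖g‖⁻¹ • g) (norm_smul_inv_norm hg))
    rwa [smul_inv_smul₀ (norm_ne_zero_iff.2 hg)] at h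

theorem separableSpace_dual_of_le {Y Z : Submodule ℝ X} (hYZ : Y ≤ Z)
    [TopologicalSpace.SeparableSpace (StrongDual ℝ Z)] :
    TopologicalSpace.SeparableSpace (StrongDual ℝ Y) := by
  let i : Y →L[ℝ] Z := Y.subtypeL.codRestrict Z fun y => hYZ y.2
  let R : StrongDual ℝ Z →L[ℝ] StrongDual ℝ Y := (ContinuousLinearMap.compL ℝ Y Z ℝ).flip i
  have hR : Function.Surjective R := fun g => by
    obtain ⟨G, hG, -⟩ := exists_extension_norm_eq Y g
    exact ⟨G.comp Z.subtypeL, ContinuousLinearMap.ext hG⟩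
  exact hR.denseRange.separableSpace R.continuous

/-! ### Lifting under each of the alternative hypotheses -/

theorem DualBallSeqCompact.liftsSphereLimits (hX : DualBallSeqCompact X) (Y : Submodule ℝ X)
    {g : StrongDual ℝ Y} (hg : ‖g‖ = 1) : LiftsSphereLimits Y g := by
  intro f hf hlim
  choose F hFf hF using fun n => exists_extension_norm_eq Y (f n)
  obtain ⟨G, hG, φ, hφ, hFG⟩ := hX (x := fun n => StrongDual.toWeakDual (F n))
    (fun n => ((hF n).trans (hf n)).le)
  have hFG' := tendsto_toWeakDual_iff (g := WeakDual.toStrongDual G).1 hFG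
  have hGg : (WeakDual.toStrongDual G).comp Y.subtypeL = g := by
    ext y
    refine tendsto_nhds_unique (hFG' y) ?_
    have := (hlim y).comp hφ.tendsto_atTop
    exact this.congr fun n => (hFf _ y).symm
  refine ⟨F ∘ φ, WeakDual.toStrongDual G, fun n => (hF _).trans (hf _), le_antisymm hG ?_, hFG',
    fun n => ⟨φ n, ContinuousLinearMap.ext fun y => (hFf _ y).symm⟩, hGg⟩
  rw [← hg, ← hGg]
  exact norm_comp_subtypeL_le Y _

theorem liftsSphereLimits_of_projection {Z : Submodule ℝ X} {P : X →L[ℝ] X} (hP : ‖P‖ ≤ 1)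
    (hPP : ∀ x, P (P x) = P x) (hPZ : range P = (Z : Set X)) {g : StrongDual ℝ Z} (hg : ‖g‖ = 1) :
    LiftsSphereLimits Z g := by
  intro f hf hlim
  let Q : X →L[ℝ] Z := P.codRestrict Z fun x => by
    rw [← SetLike.mem_coe, ← hPZ]; exact mem_range_self x
  have hQ : ∀ z : Z, Q z = z := fun z => by
    have hz : (z : X) ∈ range P := hPZ ▸ z.2
    obtain ⟨x, hx⟩ := hz
    ext
    change P z = z
    rw [← hx, hPP]
  have hres : ∀ k : StrongDual ℝ Z, (k.comp Q).comp Z.subtypeL = k := fun k => by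
    ext z
    exact congrArg k (hQ z)
  have hnorm : ∀ k : StrongDual ℝ Z, ‖k.comp Q‖ = ‖k‖ := fun k => by
    refine le_antisymm ?_ ?_
    · refine ContinuousLinearMap.opNorm_le_bound _ (norm_nonneg k) fun x => ?_
      have h1 : ‖Q x‖ ≤ ‖x‖ := by
        have := P.le_of_opNorm_le hP x
        rwa [one_mul] at this
      exact (k.le_opNorm _).trans (mul_le_mul_of_nonneg_left h1 (norm_nonneg k))
    · conv_lhs => rw [← hres k]
      exact norm_comp_subtypeL_le Z _
  exact ⟨fun n => (f n).comp Q, g.comp Q, fun n => (hnorm _).trans (hf n), (hnorm g).trans hg,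
    fun x => hlim (Q x), fun n => ⟨n, (hres _).symm⟩, hres g⟩

/-- If `g` attains its norm at `y`, all weak-star cluster points of norm-preserving extensions of a
sequence converging to `g` lie in `J(y)`; a countable neighbourhood base of one of them in
`J(y)` then yields a subsequence for which it is the only cluster point. -/
theorem DualityMapFirstCountable.liftsSphereLimits (hX : DualityMapFirstCountable X)
    {Y : Submodule ℝ X} {g : StrongDual ℝ Y} {y : Y} (hy : ‖y‖ = 1) (hgy : g y = 1) :
    LiftsSphereLimits Y g := by
  intro f hf hlim
  choose F hFf hF using fun n => exists_extension_norm_eq Y (f n)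
  let w : ℕ → WeakDual ℝ X := fun n => StrongDual.toWeakDual (F n)
  let K : Set (WeakDual ℝ X) := WeakDual.toStrongDual ⁻¹' Metric.closedBall 0 1
  have hK : IsCompact K := WeakDual.isCompact_closedBall 0 1
  have hwK : ∀ n, w n ∈ K := fun n => by
    exact mem_closedBall_zero_iff.2 ((hF n).trans (hf n)).le
  have hclK : ∀ G, MapClusterPt G atTop w → G ∈ K := fun G hG =>
    hK.isClosed.mem_of_mapClusterPt hG (Eventually.of_forall hwK)
  have hclg : ∀ G, MapClusterPt G atTop w → ∀ z : Y, G z = g z := by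
    intro G hG z
    have h1 := hG.tendsto_comp ((WeakDual.eval_continuous (z : X)).tendsto G)
    have h2 : Tendsto ((fun x : WeakDual ℝ X => x (z : X)) ∘ w) atTop (𝓝 (g z)) :=
      (hlim z).congr fun n => (hFf n z).symm
    exact eq_of_nhds_neBot (ClusterPt.mono h1 h2)
  have hclJ : ∀ G, MapClusterPt G atTop w → G ∈ dualityMap (y : X) := by
    intro G hG
    have h1 : G y = 1 := (hclg G hG y).trans hgy
    refine ⟨le_antisymm (mem_closedBall_zero_iff.1 (hclK G hG)) ?_, h1⟩
    have := (WeakDual.toStrongDual G).le_opNorm (y : X)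
    have hy' : ‖(y : X)‖ = 1 := hy
    rw [WeakDual.toStrongDual_apply, h1, hy'] at this
    simpa using this
  obtain ⟨G, -, hG⟩ := hK.exists_mapClusterPt (f := atTop) (u := w)
    (le_principal_iff.2 (mem_map.2 (Eventually.of_forall hwK)))
  have := hX (y : X) hy
  let G₀ : dualityMap (y : X) := ⟨G, hclJ G hG⟩
  have hb : (𝓝 G₀).HasBasis (fun s : Set (WeakDual ℝ X) => s ∈ 𝓝 G ∧ IsClosed s)
      (fun s => Subtype.val ⁻¹' s) := by
    rw [nhds_subtype]
    exact (closed_nhds_basis G).comap _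
  obtain ⟨s, hs, hsb⟩ := hb.exists_antitone_subbasis
  obtain ⟨φ, hφ, hφs⟩ := extraction_forall_of_frequently
    (P := fun n k => w k ∈ ⋂ i ∈ Finset.range (n + 1), s i) fun n =>
      hG.frequently ((Filter.biInter_finset_mem _).2 fun i _ => (hs i).1)
  have hwG : Tendsto (w ∘ φ) atTop (𝓝 G) := by
    refine hK.tendsto_nhds_of_unique_mapClusterPt (Eventually.of_forall fun n => hwK _) ?_
    intro G' _ hG'
    have hcl : MapClusterPt G' atTop w := hG'.of_comp hφ.tendsto_atTop
    have hsi : ∀ i, G' ∈ s i := fun i => by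
      refine (hs i).2.mem_of_mapClusterPt hG' ?_
      filter_upwards [eventually_ge_atTop i] with n hn
      exact mem_iInter₂.1 (hφs n) i (by simpa using Nat.lt_succ_of_le hn)
    by_contra hne
    have hne' : G₀ ≠ ⟨G', hclJ G' hcl⟩ := fun h => hne (congrArg Subtype.val h).symm
    obtain ⟨i, -, hi⟩ := hsb.1.mem_iff.1 (isOpen_ne.mem_nhds hne')
    exact hi (show (⟨G', hclJ G' hcl⟩ : dualityMap (y : X)) ∈ Subtype.val ⁻¹' s i from hsi i) rfl
  exact ⟨F ∘ φ, WeakDual.toStrongDual G, fun n => (hF _).trans (hf _), (hclJ G hG).1,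
    tendsto_toWeakDual_iff.1 hwG,
    fun n => ⟨φ n, ContinuousLinearMap.ext fun z => (hFf _ z).symm⟩,
    ContinuousLinearMap.ext (hclg G hG)⟩

theorem isCoseparable_ker (f : StrongDual ℝ X) : IsCoseparable f.ker := by
  refine ⟨f.isClosed_ker, ?_⟩
  -- The line through `x₀` is a complement of the kernel, unless `f = 0`, when `x₀ = 0` serves.
  obtain ⟨x₀, hx₀⟩ : ∃ x₀, ∀ x, f (x - f x • x₀) = 0 := by
    by_cases h : ∃ u, f u ≠ 0
    · obtain ⟨u, hu⟩ := h
      exact ⟨(f u)⁻¹ • u, fun x => by simp [hu]⟩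
    · push Not at h
      exact ⟨0, fun x => h _⟩
  have hsurj : Function.Surjective fun t : ℝ => f.ker.mkQL (t • x₀) := by
    intro q
    obtain ⟨x, rfl⟩ := Submodule.Quotient.mk_surjective _ q
    exact ⟨f x, ((Submodule.Quotient.eq _).2 (hx₀ x)).symm⟩
  exact hsurj.denseRange.separableSpace (by fun_prop)

/-- A sequence in the dual ball factors through the quotient by the intersection of the kernels,
which is separable, so that the sequential Banach-Alaoglu theorem applies there. -/
theorem CoseparableInter.dualBallSeqCompact (hX : CoseparableInter X) : DualBallSeqCompact X := by
  intro f hf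
  have hf1 : ∀ n x, ‖f n x‖ ≤ ‖x‖ := fun n x => by
    have := (WeakDual.toStrongDual (f n)).le_of_opNorm_le (hf n) x
    rwa [one_mul] at this
  let Z : Submodule ℝ X := ⨅ n, (WeakDual.toStrongDual (f n)).ker
  have hZ : TopologicalSpace.SeparableSpace (X ⧸ Z) := (hX _ fun n => isCoseparable_ker _).2
  let h : ℕ → StrongDual ℝ (X ⧸ Z) := fun n =>
    Z.liftQL (WeakDual.toStrongDual (f n)) (iInf_le _ n)
  have hh : ∀ n x, h n (Z.mkQL x) = f n x := fun n x => rfl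
  have hh1 : ∀ n, ‖h n‖ ≤ 1 := fun n => by
    refine ContinuousLinearMap.opNorm_le_bound _ zero_le_one fun q => ?_
    rw [one_mul]
    refine le_of_forall_pos_le_add fun ε hε => ?_
    obtain ⟨x, rfl, hx⟩ := Submodule.Quotient.norm_mk_lt q hε
    exact (hf1 n x).trans hx.le
  obtain ⟨H, -, φ, hφ, hH⟩ := WeakDual.isSeqCompact_closedBall ℝ (X ⧸ Z) 0 1
    (x := fun n => StrongDual.toWeakDual (h n)) fun n => mem_closedBall_zero_iff.2 (hh1 n)
  have hlim : ∀ x, Tendsto (fun n => f (φ n) x) atTop (𝓝 (H (Z.mkQL x))) := fun x =>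
    ((WeakDual.eval_continuous (Z.mkQL x)).tendsto H).comp hH
  let G : StrongDual ℝ X := (WeakDual.toStrongDual H).comp Z.mkQL
  refine ⟨StrongDual.toWeakDual G, ?_, φ, hφ,
    tendsto_iff_forall_eval_tendsto_topDualPairing.2 hlim⟩
  refine ContinuousLinearMap.opNorm_le_bound _ zero_le_one fun x => ?_
  rw [one_mul]
  exact le_of_tendsto' (hlim x).norm fun n => hf1 _ x

/-! ### The Bishop-Phelps theorem -/

/-- The form of Ekeland's variational principle needed for the Bishop-Phelps theorem. -/
theorem exists_le_add_mul_dist {α : Type*} [MetricSpace α] [CompleteSpace α] [Nonempty α]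
    {f : α → ℝ} (hf : Continuous f) (hb : BddAbove (range f)) {ε : ℝ} (hε : 0 < ε) :
    ∃ x₀, ∀ x, f x ≤ f x₀ + ε * dist x x₀ := by
  have step : ∀ (n : ℕ) (x : α), ∃ y, f x + ε * dist y x ≤ f y ∧
      ∀ z, f x + ε * dist z x ≤ f z → f z < f y + 1 / (n + 1 : ℝ) := by
    intro n x
    let S : Set ℝ := f '' {z | f x + ε * dist z x ≤ f z}
    have hS : S.Nonempty := ⟨f x, x, by simp, rfl⟩
    have hSb : BddAbove S := hb.mono (image_subset_range _ _)
    obtain ⟨_, ⟨y, hy, rfl⟩, hlt⟩ := exists_lt_of_lt_csSup hS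
      (show sSup S - 1 / (n + 1 : ℝ) < sSup S by
        have : (0 : ℝ) < 1 / (n + 1 : ℝ) := by positivity
        linarith)
    refine ⟨y, hy, fun z hz => ?_⟩
    have := le_csSup hSb (mem_image_of_mem f hz)
    linarith
  choose s hs1 hs2 using step
  let x : ℕ → α := fun n => Nat.rec (Classical.arbitrary α) (fun k a => s k a) n
  have hx : ∀ n, x (n + 1) = s n (x n) := fun n => rfl
  -- The relation `f a + ε * dist b a ≤ f b` is transitive.
  have htrans : ∀ a b c, f a + ε * dist b a ≤ f b → f b + ε * dist c b ≤ f c →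
      f a + ε * dist c a ≤ f c := fun a b c h1 h2 => by
    have := mul_le_mul_of_nonneg_left (dist_triangle c b a) hε.le
    linarith
  have hchain : ∀ m n, m ≤ n → f (x m) + ε * dist (x n) (x m) ≤ f (x n) := by
    intro m n hmn
    induction n, hmn using Nat.le_induction with
    | base => simp
    | succ n _ ih => exact htrans _ _ _ ih (by rw [hx]; exact hs1 n (x n))
  have hmono : Monotone fun n => f (x n) := fun m n hmn => by
    have := hchain m n hmn
    have := mul_nonneg hε.le (dist_nonneg (x := x n) (y := x m))
    linarith
  have hconv := tendsto_atTop_ciSup hmono (hb.mono (range_comp_subset_range x f))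
  have hcauchy : CauchySeq x := by
    rw [Metric.cauchySeq_iff']
    intro δ hδ
    obtain ⟨N, hN⟩ := Metric.cauchySeq_iff'.1 hconv.cauchySeq (ε * δ) (by positivity)
    refine ⟨N, fun n hn => ?_⟩
    have h1 := hN n hn
    rw [Real.dist_eq] at h1
    have h2 := hchain N n hn
    have h3 := le_abs_self (f (x n) - f (x N))
    exact lt_of_mul_lt_mul_left (by linarith) hε.le
  obtain ⟨x₀, hx₀⟩ := cauchySeq_tendsto_of_complete hcauchy
  have hfx₀ : Tendsto (fun n => f (x n)) atTop (𝓝 (f x₀)) := (hf.tendsto x₀).comp hx₀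
  have hlim : ∀ m, f (x m) + ε * dist x₀ (x m) ≤ f x₀ := fun m =>
    le_of_tendsto_of_tendsto
      (((hx₀.dist tendsto_const_nhds).const_mul ε).const_add (f (x m))) hfx₀
      ((eventually_ge_atTop m).mono fun n hn => hchain m n hn)
  refine ⟨x₀, fun z => ?_⟩
  by_contra! hz
  have h1 : ∀ n : ℕ, f z ≤ f (x (n + 1)) + 1 / (n + 1 : ℝ) := fun n =>
    (hs2 n (x n) z (htrans _ _ _ (hlim n) hz.le)).le
  have h2 : f z ≤ f x₀ + 0 := ge_of_tendsto'
    ((hfx₀.comp (tendsto_add_atTop_nat 1)).add tendsto_one_div_add_atTop_nhds_zero_nat) h1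
  have := mul_nonneg hε.le (dist_nonneg (x := z) (y := x₀))
  linarith

/-- The **Bishop-Phelps theorem**: norm-attaining functionals are dense in the dual. A point `x₀` of
the ball at which `f` is maximal up to `ε * ‖x - x₀‖` is found by Ekeland's principle; separating
the ball from the strict epigraph of `ε * ‖x - x₀‖ - f (x - x₀)` gives the approximating
functional. -/
theorem exists_norm_sub_le_and_norm_attaining {E : Type*} [NormedAddCommGroup E] [NormedSpace ℝ E]
    [CompleteSpace E] (f : StrongDual ℝ E) {ε : ℝ} (hε : 0 < ε) :
    ∃ g : StrongDual ℝ E, ‖f - g‖ ≤ ε ∧ ∃ x, ‖x‖ ≤ 1 ∧ g x = ‖g‖ := by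
  have : CompleteSpace (Metric.closedBall (0 : E) 1) :=
    Metric.isClosed_closedBall.completeSpace_coe
  have : Nonempty (Metric.closedBall (0 : E) 1) := ⟨⟨0, by simp⟩⟩
  obtain ⟨⟨x₀, hx₀⟩, hmax⟩ := exists_le_add_mul_dist (α := Metric.closedBall (0 : E) 1)
    (f := fun x => f x) (by fun_prop) ⟨‖f‖, by
      rintro _ ⟨x, rfl⟩
      exact (Real.le_norm_self _).trans (f.unit_le_opNorm _ (mem_closedBall_zero_iff.1 x.2))⟩ hε
  have hmax' : ∀ x ∈ Metric.closedBall (0 : E) 1, f x ≤ f x₀ + ε * ‖x - x₀‖ := fun x hx => by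
    have := hmax ⟨x, hx⟩
    rwa [Subtype.dist_eq, dist_eq_norm] at this
  let ψ : E → ℝ := fun x => ε * ‖x - x₀‖ - f (x - x₀)
  have hψc : Continuous ψ := by fun_prop
  have hψ : ConvexOn ℝ univ ψ := by
    have h1 : ConvexOn ℝ univ fun x : E => ‖x - x₀‖ := by
      refine ((convexOn_univ_norm (E := E)).translate_right (-x₀)).congr fun x _ => ?_
      simp [neg_add_eq_sub]
    have h2 : ConcaveOn ℝ univ fun x : E => f (x - x₀) := by
      refine ((f.toLinearMap.concaveOn convex_univ).add
        (concaveOn_const (f (-x₀)) convex_univ)).congr fun x _ => ?_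
      simp [sub_eq_add_neg]
    exact (h1.smul hε.le).sub h2
  have hC : Convex ℝ {p : E × ℝ | p.1 ∈ univ ∧ ψ p.1 < p.2} := hψ.convex_strict_epigraph
  have hCo : IsOpen {p : E × ℝ | p.1 ∈ univ ∧ ψ p.1 < p.2} := by
    simpa using isOpen_lt (hψc.comp continuous_fst) continuous_snd
  have hB : Convex ℝ (Metric.closedBall (0 : E) 1 ×ˢ Iic (0 : ℝ)) :=
    (convex_closedBall 0 1).prod (convex_Iic 0)
  obtain ⟨φ, u, h1, h2⟩ := geometric_hahn_banach_open hC hCo hB (by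
    rw [Set.disjoint_left]
    rintro ⟨x, t⟩ ⟨-, h1⟩ ⟨h2, h3⟩
    have := hmax' x h2
    simp only [ψ, map_sub, mem_Iic] at h1 h3
    linarith)
  have hsplit : ∀ (y : E) (t : ℝ), φ (y, t) = φ (y, 0) + t * φ (0, 1) := fun y t => by
    have : (y, t) = (y, (0 : ℝ)) + t • ((0 : E), (1 : ℝ)) := by simp
    rw [this, map_add, map_smul, smul_eq_mul]
  have hs : φ (0, 1) < 0 := by
    have ha := h1 (x₀, 1) (by simp [ψ])
    have hb := h2 (x₀, 0) ⟨hx₀, by simp⟩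
    rw [hsplit x₀ 1] at ha
    linarith
  set c := -φ (0, 1) with hcdef
  have hc : 0 < c := by linarith
  have hle : ∀ x, φ (x, 0) - c * ψ x ≤ u := fun x => by
    refine le_of_forall_pos_lt_add fun η hη => ?_
    have := h1 (x, ψ x + η / c) ⟨mem_univ _, by simpa using div_pos hη hc⟩
    rw [hsplit, add_mul] at this
    have h3 : η / c * φ (0, 1) = -η := by
      rw [show φ (0, 1) = -c by simp [hcdef], mul_neg, div_mul_cancel₀ _ hc.ne']
    have h4 : ψ x * φ (0, 1) = -(c * ψ x) := by
      rw [show φ (0, 1) = -c by simp [hcdef]]; ring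
    linarith
  have hu : φ (x₀, 0) = u := by
    refine le_antisymm ?_ (h2 _ ⟨hx₀, by simp⟩)
    simpa [ψ] using hle x₀
  let L : StrongDual ℝ E := φ.comp (ContinuousLinearMap.inl ℝ E ℝ)
  have hL : ∀ x, L x = φ (x, 0) := fun x => rfl
  let g : StrongDual ℝ E := -(c⁻¹ • L)
  have hg : ∀ x, g x = -(c⁻¹ * φ (x, 0)) := fun x => rfl
  have hgmax : ∀ x ∈ Metric.closedBall (0 : E) 1, g x ≤ g x₀ := fun x hx => by
    have := h2 (x, 0) ⟨hx, by simp⟩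
    rw [hg, hg, hu]
    have := mul_le_mul_of_nonneg_left this (inv_nonneg.2 hc.le)
    linarith
  have hfg : ∀ h, (f - g) h ≤ ε * ‖h‖ := fun h => by
    have h3 := hle (x₀ + h)
    have h4 : φ (x₀ + h, 0) = φ (x₀, 0) + φ (h, 0) := by rw [← map_add]; simp
    have h5 : ψ (x₀ + h) = ε * ‖h‖ - f h := by simp [ψ]
    rw [h4, hu, h5] at h3
    have h6 : c⁻¹ * φ (h, 0) ≤ ε * ‖h‖ - f h := by
      rw [inv_mul_le_iff₀ hc]; linarith
    rw [sub_apply, hg]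
    linarith
  refine ⟨g, ContinuousLinearMap.opNorm_le_bound _ hε.le fun h => ?_, x₀, by simpa using hx₀, ?_⟩
  · rw [Real.norm_eq_abs, abs_le]
    have h3 := hfg (-h)
    rw [map_neg, norm_neg] at h3
    exact ⟨by linarith, hfg h⟩
  · refine le_antisymm ((Real.le_norm_self _).trans (g.unit_le_opNorm _ (by simpa using hx₀))) ?_
    refine ContinuousLinearMap.opNorm_le_of_unit_norm ?_ fun x hx => ?_
    · simpa using hgmax 0 (by simp)
    · rw [Real.norm_eq_abs, abs_le]
      have h3 := hgmax (-x) (by simp [hx])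
      rw [map_neg] at h3
      exact ⟨by linarith, hgmax x (by simp [hx])⟩

theorem eq_top_of_norm_attaining_mem {E : Type*} [NormedAddCommGroup E] [NormedSpace ℝ E]
    [CompleteSpace E] {W : Submodule ℝ (StrongDual ℝ E)} (hWc : IsClosed (W : Set (StrongDual ℝ E)))
    (hW : ∀ (g : StrongDual ℝ E) (x : E), ‖g‖ = 1 → ‖x‖ = 1 → g x = 1 → g ∈ W) : W = ⊤ := by
  refine Submodule.eq_top_iff'.2 fun f => ?_
  rw [← SetLike.mem_coe, ← hWc.closure_eq, Metric.mem_closure_iff]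
  intro ε hε
  obtain ⟨g, hfg, x, hx, hgx⟩ := exists_norm_sub_le_and_norm_attaining f (half_pos hε)
  refine ⟨g, ?_, by rw [dist_eq_norm]; linarith⟩
  rcases eq_or_ne g 0 with rfl | hg
  · exact W.zero_mem
  have hg' : 0 < ‖g‖ := norm_pos_iff.2 hg
  have hx1 : ‖x‖ = 1 := by
    refine le_antisymm hx ?_
    have h1 : ‖g‖ * 1 ≤ ‖g‖ * ‖x‖ := by
      rw [mul_one]
      calc ‖g‖ = g x := hgx.symm
        _ ≤ ‖g x‖ := Real.le_norm_self _
        _ ≤ ‖g‖ * ‖x‖ := g.le_opNorm x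
    exact le_of_mul_le_mul_left h1 hg'
  have h := W.smul_mem ‖g‖ (hW (‖g‖⁻¹ • g) x (norm_smul_inv_norm hg) hx1 (by
    simp [hgx, hg'.ne']))
  rwa [smul_inv_smul₀ hg'.ne'] at h

/-! ### The weak Kadec-Klee property implies the Asplund property -/

theorem DualWeakKadecKlee.isAsplund [CompleteSpace X] (hX : DualWeakKadecKlee X)
    (h : DualityMapFirstCountable X ∨ CoseparableInter X ∨ HasOneSCP X ∨ DualBallSeqCompact X) :
    IsAsplund X := by
  refine isAsplund_of_separable_dual_of_separable fun Y hYc hYs => ?_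
  have hseq (hb : DualBallSeqCompact X) : TopologicalSpace.SeparableSpace (StrongDual ℝ Y) :=
    hX.separableSpace_dual hYs fun W _ hW =>
      eq_top_of_sphere_subset fun g hg => hW g hg (hb.liftsSphereLimits Y hg)
  rcases h with h | h | h | h
  · have : CompleteSpace Y := hYc.completeSpace_coe
    exact hX.separableSpace_dual hYs fun W hWc hW =>
      eq_top_of_norm_attaining_mem hWc fun g y hg hy hgy =>
        hW g hg (h.liftsSphereLimits hy hgy)
  · exact hseq h.dualBallSeqCompact
  · obtain ⟨Z, P, hZs, hYZ, hP, hPP, hPZ⟩ := h Y hYs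
    have := hX.separableSpace_dual hZs fun W _ hW =>
      eq_top_of_sphere_subset fun g hg => hW g hg (liftsSphereLimits_of_projection hP hPP hPZ hg)
    exact separableSpace_dual_of_le hYZ
  · exact hseq h

/-! ### Gateaux differentiability spaces -/

/-- A sequence `f` in the dual ball has the convex Lipschitz upper envelope
`p x = limsup (f n x)`. Where `p` is Gateaux differentiable, a subsequence along which `f n x` tends
to `p x` must converge weak-star to the gradient. -/
theorem IsGDS.dualBallSeqCompact (hX : IsGDS X) : DualBallSeqCompact X := by
  intro f hf
  have hf1 : ∀ n x, |f n x| ≤ ‖x‖ := fun n x => by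
    have := (WeakDual.toStrongDual (f n)).le_of_opNorm_le (hf n) x
    rwa [one_mul] at this
  have hub : ∀ x (l : Filter ℕ), IsBoundedUnder (· ≤ ·) l fun n => f n x := fun x l =>
    isBoundedUnder_of ⟨‖x‖, fun n => (abs_le.1 (hf1 n x)).2⟩
  have hlb : ∀ x (l : Filter ℕ), IsBoundedUnder (· ≥ ·) l fun n => f n x := fun x l =>
    isBoundedUnder_of ⟨-‖x‖, fun n => (abs_le.1 (hf1 n x)).1⟩
  let p : X → ℝ := fun x => limsup (fun n => f n x) atTop
  have hp_lt : ∀ x c, p x < c → ∀ᶠ n in atTop, f n x < c := fun x c h =>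
    eventually_lt_of_limsup_lt h (hub x _)
  have hp_le : ∀ x c, (∀ᶠ n in atTop, f n x ≤ c) → p x ≤ c := fun x c h =>
    limsup_le_of_le (hlb x _).isCoboundedUnder_le h
  have hp_conv : ConvexOn ℝ univ p := by
    refine ⟨convex_univ, fun x _ y _ a b ha hb hab => ?_⟩
    refine le_of_forall_pos_le_add fun ε hε => hp_le _ _ ?_
    filter_upwards [hp_lt x (p x + ε) (by linarith), hp_lt y (p y + ε) (by linarith)] with n h1 h2
    have e : f n (a • x + b • y) = a * f n x + b * f n y := by simp
    have h3 := mul_le_mul_of_nonneg_left h1.le ha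
    have h4 := mul_le_mul_of_nonneg_left h2.le hb
    have h5 : a * ε + b * ε = ε := by rw [← add_mul, hab, one_mul]
    rw [e, smul_eq_mul, smul_eq_mul]
    linarith
  have hp_lip : ∀ x y, p x ≤ p y + 1 * dist x y := fun x y => by
    rw [one_mul]
    refine le_of_forall_pos_le_add fun ε hε => hp_le _ _ ?_
    filter_upwards [hp_lt y (p y + ε) (by linarith)] with n h1
    have h2 := (abs_le.1 (hf1 n (x - y))).2
    rw [map_sub, ← dist_eq_norm] at h2
    linarith
  obtain ⟨D, hD, hdiff⟩ := hX p hp_conv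
    (LipschitzWith.of_le_add_mul (K := 1) hp_lip).continuous
  obtain ⟨x, hx⟩ := hD.nonempty
  obtain ⟨L, hL⟩ := hdiff x hx
  -- Only the lower bound matters: the upper one follows from the definition of `p`.
  obtain ⟨φ, hφ, hφx⟩ : ∃ φ : ℕ → ℕ, StrictMono φ ∧
      ∀ n : ℕ, p x - 1 / (n + 1 : ℝ) < f (φ n) x :=
    extraction_forall_of_frequently fun n => frequently_lt_of_lt_limsup
      (hlb x _).isCoboundedUnder_le (by
        have : (0 : ℝ) < 1 / (n + 1 : ℝ) := by positivity
        change p x - _ < p x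
        linarith)
  -- Difference quotients of `p` at `x` bound the values `f (φ n) h` from above.
  have hupper : ∀ h c, L h < c → ∀ᶠ n in atTop, f (φ n) h < c := by
    intro h c hc
    have hslope := (hL h).tendsto_slope_zero_right
    obtain ⟨t, ht, ht0⟩ := ((hslope.eventually (gt_mem_nhds hc)).and
      self_mem_nhdsWithin).exists
    have ht0 : 0 < t := ht0
    rw [smul_eq_mul] at ht
    rw [inv_mul_lt_iff₀ ht0] at ht
    set η := t * c - (p (x + t • h) - p x) with hη
    have hη0 : 0 < η := by linarith
    have h1 := hφ.tendsto_atTop.eventually (hp_lt (x + t • h) (p (x + t • h) + η / 2) (by linarith))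
    have h2 := (tendsto_one_div_add_atTop_nhds_zero_nat (𝕜 := ℝ)).eventually
      (gt_mem_nhds (half_pos hη0))
    filter_upwards [h1, h2] with n h1 h2
    rw [map_add, map_smul, smul_eq_mul] at h1
    have h3 := hφx n
    exact lt_of_mul_lt_mul_left (by linarith) ht0.le
  have hlim : ∀ h, Tendsto (fun n => f (φ n) h) atTop (𝓝 (L h)) := fun h => by
    refine tendsto_order.2 ⟨fun c hc => ?_, hupper h⟩
    filter_upwards [hupper (-h) (-c) (by rw [map_neg]; linarith)] with n hn
    rw [map_neg] at hn
    linarith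
  refine ⟨StrongDual.toWeakDual L, ?_, φ, hφ,
    tendsto_iff_forall_eval_tendsto_topDualPairing.2 hlim⟩
  refine ContinuousLinearMap.opNorm_le_bound _ zero_le_one fun h => ?_
  rw [one_mul]
  exact le_of_tendsto' (hlim h).norm fun n => hf1 _ h

theorem IsWeakAsplund.isGDS (hX : IsWeakAsplund X) : IsGDS X := fun f hf hc =>
  let ⟨D, hD, _, hdiff⟩ := hX f hf hc
  ⟨D, hD, hdiff⟩

end

/-- A renorming of `X` is given as a normed space `Y` that is linearly homeomorphic to `X`
(equivalently: transport the norm of `Y` to `X` to get an equivalent norm). -/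
theorem theorem1 (X : Type u) [NormedAddCommGroup X] [NormedSpace ℝ X] [CompleteSpace X] :
    ((∃ (Y : Type u) (_ : NormedAddCommGroup Y) (_ : NormedSpace ℝ Y),
        Nonempty (X ≃L[ℝ] Y) ∧ DualWeakKadecKlee Y ∧
          (DualityMapFirstCountable Y ∨ CoseparableInter Y ∨ HasOneSCP Y ∨
            DualBallSeqCompact Y)) →
      IsAsplund X) ∧
    (IsGDS X → DualBallSeqCompact X) ∧
    (IsWeakAsplund X → DualBallSeqCompact X) := by
  refine ⟨?_, IsGDS.dualBallSeqCompact, fun h => h.isGDS.dualBallSeqCompact⟩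
  rintro ⟨Y, _, _, ⟨e⟩, hY, h⟩
  have : CompleteSpace Y := (completeSpace_congr (e := e.toEquiv) e.isUniformEmbedding).1 ‹_›
  exact IsAsplund.of_continuousLinearEquiv e (hY.isAsplund h)
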